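/- Consider the discrete-time linear time-invariant descriptor system $$E x_{k+1}=A x_k+B u_k+w_k,\qquad y_{k+1}=H x_{k+1}+v_k,$$ with real matrices $E,A\in\mathbb{R}^{n_1\times n}$, $B\in\mathbb{R}^{n_1\times q}$, $H\in\mathbb{R}^{m\times n}$ ($E$ and $A$ not necessarily square), and let $Q\in\mathbb{R}^{n_1\times n_1}$, $R\in\mathbb{R}^{m\times m}$, $P_0\in\mathbb{R}^{n\times n}$ be symmetric positive definite weighting matrices. Define, for $k\ge 0$, $$P_0^{(+)}=P_0,\qquad P_k^{(-)}=A P_k^{(+)}A^T+Q,\qquad P_{k+1}^{(+)}=\bigl(E^T(P_k^{(-)})^{-1}E+H^TR^{-1}H\bigr)^{-1},$$ $$\Gamma_k^{sm}=\bigl((P_k^{(+)})^{-1}+A^TQ^{-1}A\bigr)^{-1},$$ and, for $b\ge 0$, the coupling matrices $$M_1^{b}=I,\qquad M_i^{b}=M_{i-1}^{b}\,\Gamma_{b+i-1}^{sm}A^TQ^{-1}E\quad(i\ge 2).$$ Assume that the system is detectable, i.e. $$\operatorname{rank}\begin{bmatrix}\mu E-\varphi A\\ H\end{bmatrix}=n\quad\text{for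 all complex }(\mu,\varphi)\neq(0,0)\text{ with }|\mu|\ge|\varphi|,$$ and stabilizable, i.e. $$\operatorname{rank}\begin{bmatrix}\mu E-\varphi A&Q&0\\ \mu H&0&R\end{bmatrix}=n_1+m\quad\text{for almost all complex }(\mu,\varphi)\neq(0,0)\text{ with }|\mu|\ge|\varphi|.$$ Then, with $\|\cdot\|_{i2}$ the matrix norm induced by the Euclidean norm, $$\bigl\|(\Gamma_{b+1}^{sm})^{-1}M_{c}^{b}\bigr\|_{i2}\longrightarrow 0\quad\text{as } b,c\to\infty ,$$ i.e. for every $\varepsilon>0$ there is $N$ such that the norm is less than $\varepsilon$ whenever $b\ge N$ and $c\ge N$. -/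

import Mathlib

open Filter Topology MeasureTheory

noncomputable section

/-- The linear time-invariant discrete-time descriptor system
`E x_{k+1} = A x_k + B u_k + w_k`, `y_{k+1} = H x_{k+1} + v_k`
with `n` states, `n₁` state equations, `q` inputs and `m` outputs.
The matrices `E` and `A` need not be square, and `E` may be rank deficient. -/
structure DescriptorSystem (n n₁ q m : ℕ) where
  E : Matrix (Fin n₁) (Fin n) ℝ
  A : Matrix (Fin n₁) (Fin n) ℝ
  B : Matrix (Fin n₁) (Fin q) ℝ
  H : Matrix (Fin m) (Fin n) ℝ

namespace DescriptorSystem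

variable {n n₁ q m : ℕ}

/-- The complex matrix `μ E - φ A`. -/
def pencil (S : DescriptorSystem n n₁ q m) (μ φ : ℂ) : Matrix (Fin n₁) (Fin n) ℂ :=
  μ • S.E.map Complex.ofReal - φ • S.A.map Complex.ofReal

/-- Detectability: the matrix with block rows `μ E - φ A` and `H` has rank `n` for all complex
pairs `(μ, φ) ≠ (0, 0)` with `|φ| ≤ |μ|`. -/
def Detectable (S : DescriptorSystem n n₁ q m) : Prop :=
  ∀ μ φ : ℂ, (μ, φ) ≠ (0, 0) → ‖φ‖ ≤ ‖μ‖ →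
    (Matrix.fromRows (S.pencil μ φ) (S.H.map Complex.ofReal)).rank = n

/-- Stabilizability: the matrix `[μ E - φ A, Q, 0; μ H, 0, R]` has rank `n₁ + m` for almost all
complex pairs `(μ, φ) ≠ (0, 0)` with `|φ| ≤ |μ|`. -/
def Stabilizable (S : DescriptorSystem n n₁ q m) (Q : Matrix (Fin n₁) (Fin n₁) ℝ)
    (R : Matrix (Fin m) (Fin m) ℝ) : Prop :=
  ∀ᵐ p : ℂ × ℂ, p ≠ (0, 0) → ‖p.2‖ ≤ ‖p.1‖ →
    (Matrix.fromRows
      (Matrix.fromCols (S.pencil p.1 p.2)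
        (Matrix.fromCols (Q.map Complex.ofReal) (0 : Matrix (Fin n₁) (Fin m) ℂ)))
      (Matrix.fromCols (p.1 • S.H.map Complex.ofReal)
        (Matrix.fromCols (0 : Matrix (Fin m) (Fin n₁) ℂ) (R.map Complex.ofReal)))).rank = n₁ + m

/-- The time update `P⁽⁻⁾ = A P⁽⁺⁾ Aᵀ + Q`. -/
def covMinus (S : DescriptorSystem n n₁ q m) (Q : Matrix (Fin n₁) (Fin n₁) ℝ)
    (P : Matrix (Fin n) (Fin n) ℝ) : Matrix (Fin n₁) (Fin n₁) ℝ :=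
  S.A * P * S.A.transpose + Q

/-- The descriptor Riccati recursion for `P_k⁽⁺⁾`, started at `P_0⁽⁺⁾ = P₀`:
`P_{k+1}⁽⁺⁾ = (Eᵀ (P_k⁽⁻⁾)⁻¹ E + Hᵀ R⁻¹ H)⁻¹`, where `P_k⁽⁻⁾ = A P_k⁽⁺⁾ Aᵀ + Q`. -/
def covPlus (S : DescriptorSystem n n₁ q m) (Q : Matrix (Fin n₁) (Fin n₁) ℝ)
    (R : Matrix (Fin m) (Fin m) ℝ) (P₀ : Matrix (Fin n) (Fin n) ℝ) :
    ℕ → Matrix (Fin n) (Fin n) ℝ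
  | 0 => P₀
  | k + 1 => (S.E.transpose * (S.covMinus Q (S.covPlus Q R P₀ k))⁻¹ * S.E
      + S.H.transpose * R⁻¹ * S.H)⁻¹

/-- The smoother covariance `Γ_k = ((P_k⁽⁺⁾)⁻¹ + Aᵀ Q⁻¹ A)⁻¹`. -/
def smoothCov (S : DescriptorSystem n n₁ q m) (Q : Matrix (Fin n₁) (Fin n₁) ℝ)
    (R : Matrix (Fin m) (Fin m) ℝ) (P₀ : Matrix (Fin n) (Fin n) ℝ) (k : ℕ) :
    Matrix (Fin n) (Fin n) ℝ :=
  ((S.covPlus Q R P₀ k)⁻¹ + S.A.transpose * Q⁻¹ * S.A)⁻¹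

/-- The coupling matrices of an unconstrained window that follows time `b`:
`M_1 = I` and `M_i = M_{i-1} Γ_{b+i-1} Aᵀ Q⁻¹ E` for `i ≥ 2`.
(The index `0` does not occur; the value there is a placeholder.) -/
def couplingMatrix (S : DescriptorSystem n n₁ q m) (Q : Matrix (Fin n₁) (Fin n₁) ℝ)
    (R : Matrix (Fin m) (Fin m) ℝ) (P₀ : Matrix (Fin n) (Fin n) ℝ) (b : ℕ) :
    ℕ → Matrix (Fin n) (Fin n) ℝ
  | 0 => 1
  | 1 => 1
  | i + 2 => S.couplingMatrix Q R P₀ b (i + 1) *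
      (S.smoothCov Q R P₀ (b + (i + 1)) * S.A.transpose * Q⁻¹ * S.E)

end DescriptorSystem

/-- The matrix norm induced by the Euclidean vector norm. -/
def inducedTwoNorm {n : ℕ} (M : Matrix (Fin n) (Fin n) ℝ) : ℝ :=
  ‖Matrix.toEuclideanCLM (n := Fin n) (𝕜 := ℝ) M‖

end

/-! Let `V_k(x) = xᵀ (P_k⁽⁺⁾)⁻¹ x` and `z = Γ_k Aᵀ Q⁻¹ E x`. Then `z` minimizes `V_k(z) + (E x - A
z)ᵀ Q⁻¹ (E x - A z)`, and `V_{k+1}(x)` is this minimum plus `(H x)ᵀ R⁻¹ (H x)` (`energy_succ`). So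
each coupling factor carries a state one step back in time and loses energy, and it remains to make
the loss uniform in `k`.

Detectability gives a norm `N` with `N x ≤ ρ N z + γ (‖E x - A z‖ + ‖H x‖)` and `ρ < 1`
(`exists_norm_of_detectable_pencil`). By induction on the energy balance, `V_k ≥ c N²`
(`exists_le_energy`). With this bound, the loss in a step is at least `ε ‖x‖²`
(`exists_dissipation`). The matrices `(P_k⁽⁺⁾)⁻¹`, `k ≥ 1`, are bounded above, so the energy
contracts by a fixed factor `r < 1` per step. Hence `M_c` decays geometrically, uniformly in `b`,
and the bounded factor `Γ_{b+1}⁻¹` does no harm. -/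

/-! ### Norms contracted up to an output, for detectable pairs and pencils. -/

namespace OutputContraction

open Polynomial

variable {V W Z : Type*} [NormedAddCommGroup V] [NormedSpace ℂ V]
  [NormedAddCommGroup W] [NormedSpace ℂ W] [NormedAddCommGroup Z] [NormedSpace ℂ Z]

/-- The seminorm `N` is contracted by `F`, up to a multiple of the norm of the output `C z`. -/
def IsOutputContraction (F : Module.End ℂ V) (C : V →ₗ[ℂ] W) (N : Seminorm ℂ V) : Prop :=
  ∃ ρ γ : ℝ, 0 ≤ ρ ∧ ρ < 1 ∧ 0 ≤ γ ∧ ∀ z, N (F z) ≤ ρ * N z + γ * ‖C z‖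

lemma isOutputContraction_bot (F : Module.End ℂ V) (C : V →ₗ[ℂ] W) :
    IsOutputContraction F C ⊥ :=
  ⟨0, 0, le_rfl, one_pos, le_rfl, fun z => by simp⟩

/-- A linear map that is contracted up to a contracted seminorm and the output is dominated by a
contracted seminorm. -/
lemma IsOutputContraction.exists_add {F : Module.End ℂ V} {C : V →ₗ[ℂ] W} {N : Seminorm ℂ V}
    (hN : IsOutputContraction F C N) (y : V →ₗ[ℂ] Z) {a b d : ℝ} (ha : 0 ≤ a) (ha' : a < 1)
    (hb : 0 ≤ b) (hd : 0 ≤ d) (hy : ∀ z, ‖y (F z)‖ ≤ a * ‖y z‖ + b * N z + d * ‖C z‖) :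
    ∃ N' : Seminorm ℂ V, IsOutputContraction F C N' ∧ (∀ z, N z ≤ N' z) ∧ ∀ z, ‖y z‖ ≤ N' z := by
  obtain ⟨ρ, γ, hρ, hρ', hγ, h⟩ := hN
  have h1 : 0 < 1 - ρ := by linarith
  -- The new seminorm is `‖y z‖ + κ N z`; this weight lets the slack `1 - ρ` of `N` absorb the
  -- coupling `b`, leaving the rate `(1 + ρ) / 2`.
  set κ : ℝ := 1 + 2 * b / (1 - ρ) with hκ
  have hκ1 : 1 ≤ κ := by
    have : 0 ≤ 2 * b / (1 - ρ) := by positivity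
    linarith
  have hκb : b + κ * ρ ≤ κ * ((1 + ρ) / 2) := by
    have : κ * (1 - ρ) = (1 - ρ) + 2 * b := by rw [hκ]; field_simp
    nlinarith
  have happ : ∀ z, ((normSeminorm ℂ Z).comp y + Real.toNNReal κ • N) z
      = ‖y z‖ + κ * N z := fun z => by
    rw [add_apply, smul_apply, NNReal.smul_def, Real.coe_toNNReal κ (by linarith)]
    rfl
  refine ⟨(normSeminorm ℂ Z).comp y + Real.toNNReal κ • N,
    ⟨max a ((1 + ρ) / 2), d + κ * γ, le_max_of_le_left ha, max_lt ha' (by linarith),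
      by positivity, fun z => ?_⟩, fun z => ?_, fun z => ?_⟩
  · rw [happ, happ]
    have hNz := apply_nonneg N z
    calc ‖y (F z)‖ + κ * N (F z)
        ≤ (a * ‖y z‖ + b * N z + d * ‖C z‖) + κ * (ρ * N z + γ * ‖C z‖) := by
          gcongr
          · exact hy z
          · exact h z
      _ = a * ‖y z‖ + (b + κ * ρ) * N z + (d + κ * γ) * ‖C z‖ := by ring
      _ ≤ max a ((1 + ρ) / 2) * ‖y z‖ + (κ * max a ((1 + ρ) / 2)) * N z
          + (d + κ * γ) * ‖C z‖ := by
          gcongr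
          · exact le_max_left _ _
          · exact hκb.trans (by gcongr; exact le_max_right _ _)
      _ = _ := by ring
  · rw [happ]
    nlinarith [apply_nonneg N z, norm_nonneg (y z)]
  · rw [happ]
    nlinarith [apply_nonneg N z, norm_nonneg (y z)]

lemma iterate_divX_coeff (p : ℂ[X]) (i k : ℕ) : (divX^[i] p).coeff k = p.coeff (k + i) := by
  induction i generalizing k with
  | zero => rfl
  | succ i ih => rw [Function.iterate_succ_apply', coeff_divX, ih]; congr 1; omega

lemma Monic.iterate_divX_natDegree {p : ℂ[X]} (hp : p.Monic) : divX^[p.natDegree] p = 1 := by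
  ext k
  rw [iterate_divX_coeff, coeff_one]
  rcases Nat.eq_zero_or_pos k with rfl | hk
  · simpa using hp.coeff_natDegree
  · rw [coeff_eq_zero_of_natDegree_lt (by omega), if_neg hk.ne']

/-- One Horner step along the dynamics `F`. -/
lemma aeval_divX_apply (F : Module.End ℂ V) (p : ℂ[X]) (z : V) :
    aeval F (divX p) (F z) = aeval F p z - p.coeff 0 • z := by
  conv_rhs => rw [← divX_mul_X_add p]
  simp [Module.End.mul_apply, Module.algebraMap_end_apply]

/-- Along the Horner scheme of an annihilating polynomial, all outputs are dominated by one
contracted seminorm. -/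
lemma exists_horner (F : Module.End ℂ V) (C : V →ₗ[ℂ] W) {p : ℂ[X]} (hp : aeval F p = 0) (d : ℕ) :
    ∃ N : Seminorm ℂ V, IsOutputContraction F C N ∧
      ∀ i ≤ d, ∀ z, ‖C (aeval F (divX^[i] p) z)‖ ≤ N z := by
  induction d with
  | zero =>
    refine ⟨⊥, isOutputContraction_bot F C, fun i hi z => ?_⟩
    obtain rfl : i = 0 := by omega
    simp [hp]
  | succ d ih =>
    obtain ⟨N, hN, hNd⟩ := ih
    -- The Horner outputs form a cascade: the next one at `F z` is the previous one at `z` minus a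
    -- multiple of `C z`, hence the rate `a = 0`.
    obtain ⟨N', hN', hle, hy⟩ := hN.exists_add (C ∘ₗ aeval F (divX^[d + 1] p))
      (a := 0) (b := 1) (d := ‖(divX^[d] p).coeff 0‖) le_rfl one_pos zero_le_one (norm_nonneg _)
      (fun z => by
        rw [Function.iterate_succ_apply', LinearMap.comp_apply, aeval_divX_apply, map_sub, map_smul,
          zero_mul, zero_add, one_mul]
        refine (norm_sub_le _ _).trans ?_
        rw [norm_smul]
        gcongr
        exact hNd d le_rfl z)
    refine ⟨N', hN', fun i hi z => ?_⟩
    rcases Nat.lt_or_eq_of_le hi with hi | rfl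
    · exact (hNd i (by omega) z).trans (hle z)
    · exact hy z

lemma exists_factor {K V V₁ V₂ : Type*} [Field K] [AddCommGroup V] [Module K V] [AddCommGroup V₁]
    [Module K V₁] [AddCommGroup V₂] [Module K V₂] (f : V →ₗ[K] V₁) (g : V →ₗ[K] V₂)
    (h : f.ker ≤ g.ker) : ∃ k : V₁ →ₗ[K] V₂, g = k ∘ₗ f := by
  obtain ⟨k, hk⟩ := LinearMap.exists_extend
    ((f.ker.liftQ g h) ∘ₗ (f.quotKerEquivRange.symm : f.range →ₗ[K] V ⧸ f.ker))
  refine ⟨k, LinearMap.ext fun v => ?_⟩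
  have := LinearMap.congr_fun hk ⟨f v, LinearMap.mem_range_self f v⟩
  simp only [LinearMap.comp_apply, Submodule.subtype_apply] at this
  rw [LinearMap.comp_apply, this]
  simp [LinearMap.quotKerEquivRange_symm_apply_image]

/-- If a product of factors `F - λ` with `|λ| < 1` is dominated by a contracted seminorm, then so
is the norm. -/
lemma IsOutputContraction.exists_norm_le {F : Module.End ℂ V} {C : V →ₗ[ℂ] W} (s : Multiset ℂ)
    (hs : ∀ a ∈ s, ‖a‖ < 1) {N : Seminorm ℂ V} (hN : IsOutputContraction F C N) {K : ℝ}
    (hK : 0 ≤ K) (h : ∀ z, ‖aeval F (s.map fun a => X - Polynomial.C a).prod z‖ ≤ K * N z) :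
    ∃ N' : Seminorm ℂ V, IsOutputContraction F C N' ∧ ∃ K' : ℝ, 0 ≤ K' ∧ ∀ z, ‖z‖ ≤ K' * N' z := by
  induction s using Multiset.induction_on generalizing N K with
  | empty => exact ⟨N, hN, K, hK, by simpa using h⟩
  | cons a s ih =>
    set q : ℂ[X] := (s.map fun a => X - Polynomial.C a).prod with hq
    obtain ⟨N', hN', hle, hy⟩ := hN.exists_add (aeval F q) (norm_nonneg a)
      (hs a (Multiset.mem_cons_self a s)) hK le_rfl (fun z => by
        -- Dropping one root costs the rate `‖a‖ < 1`, driven by the product already dominated.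
        have h1 : aeval F q (F z) = a • aeval F q z + aeval F ((X - Polynomial.C a) * q) z := by
          rw [mul_comm]
          simp [Module.End.mul_apply, Module.algebraMap_end_apply]
        have h2 := h z
        rw [Multiset.map_cons, Multiset.prod_cons, ← hq] at h2
        rw [h1, zero_mul, add_zero]
        refine (norm_add_le _ _).trans ?_
        rw [norm_smul]
        gcongr)
    exact ih (fun b hb => hs b (Multiset.mem_cons_of_mem hb)) hN' zero_le_one
      (fun z => by simpa using hy z)

lemma aeval_restrict_apply (F : Module.End ℂ V) {U : Submodule ℂ V} (hU : ∀ u ∈ U, F u ∈ U)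
    (p : ℂ[X]) (u : U) : (aeval (F.restrict hU) p u : V) = aeval F p (u : V) := by
  induction p using Polynomial.induction_on generalizing u with
  | C a => simp [Module.algebraMap_end_apply]
  | add p q hp hq => simp [hp, hq]
  | monomial k a ih =>
    rw [pow_succ, ← mul_assoc, map_mul (aeval (F.restrict hU)) (_ * _), map_mul (aeval F) (_ * _),
      Module.End.mul_apply, Module.End.mul_apply, aeval_X, aeval_X, ih]
    rfl

lemma _root_.Seminorm.exists_le_norm [FiniteDimensional ℂ V] (N : Seminorm ℂ V) :
    ∃ L : ℝ, 0 ≤ L ∧ ∀ z, N z ≤ L * ‖z‖ := by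
  let b := Module.finBasis ℂ V
  let c := fun i => LinearMap.toContinuousLinearMap (b.coord i)
  refine ⟨∑ i, ‖c i‖ * N (b i), Finset.sum_nonneg fun i _ => by positivity, fun z => ?_⟩
  calc N z = N (∑ i, b.repr z i • b i) := by rw [b.sum_repr]
    _ ≤ ∑ i, N (b.repr z i • b i) :=
        Finset.le_sum_of_subadditive N (map_zero N).le (map_add_le_add N) _ _
    _ ≤ ∑ i, ‖c i‖ * N (b i) * ‖z‖ := Finset.sum_le_sum fun i _ => by
        rw [map_smul_eq_mul, mul_right_comm]
        gcongr
        exact (c i).le_opNorm z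
    _ = _ := by rw [Finset.sum_mul]

/-- A detectable pair `(F, C)` admits a norm that `F` contracts up to the output. -/
theorem exists_norm_of_detectable [FiniteDimensional ℂ V] [FiniteDimensional ℂ W]
    (F : Module.End ℂ V) (C : V →ₗ[ℂ] W)
    (h : ∀ (a : ℂ) (v : V), 1 ≤ ‖a‖ → F v = a • v → C v = 0 → v = 0) :
    ∃ N : Seminorm ℂ V, IsOutputContraction F C N ∧ ∃ K : ℝ, 0 ≤ K ∧ ∀ z, ‖z‖ ≤ K * N z := by
  set p := minpoly ℂ F with hp
  have hmonic : p.Monic := minpoly.monic (Algebra.IsIntegral.isIntegral F)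
  have hp0 : aeval F p = 0 := minpoly.aeval ℂ F
  set d := p.natDegree with hd
  obtain ⟨N, hN, hNy⟩ := exists_horner F C hp0 d
  -- The kernel of `Y` is an `F`-invariant subspace of `ker C`: the last Horner polynomial is `1`,
  -- so `C` itself is among the outputs. By detectability, `F` has only eigenvalues of modulus below
  -- 1 there.
  let Y : V →ₗ[ℂ] (Fin (d + 1) → W) := LinearMap.pi fun i => C ∘ₗ aeval F (divX^[(i : ℕ)] p)
  have hYN : ∀ z, ‖Y z‖ ≤ N z := fun z =>
    (pi_norm_le_iff_of_nonneg (apply_nonneg N z)).2 fun i => hNy i (by omega) z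
  have hY : ∀ z, z ∈ Y.ker ↔ ∀ i ≤ d, C (aeval F (divX^[i] p) z) = 0 := fun z => by
    rw [LinearMap.mem_ker, funext_iff]
    exact ⟨fun h i hi => h ⟨i, by omega⟩, fun h i => h i (by omega)⟩
  have hC : ∀ z ∈ Y.ker, C z = 0 := fun z hz => by
    have := (hY z).1 hz d le_rfl
    rwa [Monic.iterate_divX_natDegree hmonic, map_one] at this
  have hU : ∀ z ∈ Y.ker, F z ∈ Y.ker := fun z hz => (hY _).2 fun i hi => by
    rcases i with _ | i
    · simp [hp0]
    · rw [Function.iterate_succ_apply', aeval_divX_apply, map_sub, map_smul, hC z hz,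
        (hY z).1 hz i (by omega)]
      simp
  set F' : Module.End ℂ Y.ker := F.restrict hU with hF'
  set g := minpoly ℂ F' with hg
  have hgs : g = (g.roots.map fun a => X - Polynomial.C a).prod :=
    (IsAlgClosed.splits g).eq_prod_roots_of_monic (minpoly.monic (Algebra.IsIntegral.isIntegral F'))
  have hroots : ∀ a ∈ g.roots, ‖a‖ < 1 := fun a ha => by
    by_contra hcon
    obtain ⟨u, hu⟩ :=
      (Module.End.hasEigenvalue_of_isRoot (isRoot_of_mem_roots ha)).exists_hasEigenvector
    refine hu.2 (Subtype.ext (h a u (not_lt.1 hcon) ?_ (hC u u.2)))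
    exact congrArg Subtype.val hu.apply_eq_smul
  -- `g(F)` vanishes on `ker Y`, so it is a linear function of `Y` and is dominated by `N`; the
  -- roots of `g` can then be peeled off.
  obtain ⟨k, hk⟩ := exists_factor Y (aeval F g) fun z hz => by
    rw [LinearMap.mem_ker, ← aeval_restrict_apply F hU g ⟨z, hz⟩]
    rw [hg, minpoly.aeval]
    rfl
  refine hN.exists_norm_le g.roots hroots (norm_nonneg (LinearMap.toContinuousLinearMap k))
    fun z => ?_
  rw [← hgs, hk]
  exact ((LinearMap.toContinuousLinearMap k).le_opNorm (Y z)).trans (by gcongr; exact hYN z)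

/-- A detectable descriptor triple `(e, a, h)` admits a norm that contracts along the trajectories
of `e x = a z`, `h x = 0`. -/
theorem exists_norm_of_detectable_pencil [FiniteDimensional ℂ V] [FiniteDimensional ℂ W]
    [FiniteDimensional ℂ Z] (e a : V →ₗ[ℂ] W) (h : V →ₗ[ℂ] Z)
    (hdet : ∀ (μ φ : ℂ) (v : V), (μ, φ) ≠ (0, 0) → ‖φ‖ ≤ ‖μ‖ → μ • e v = φ • a v → h v = 0 → v = 0) :
    ∃ (N : Seminorm ℂ V) (ρ γ K : ℝ), 0 ≤ ρ ∧ ρ < 1 ∧ 0 ≤ γ ∧ 0 ≤ K ∧ (∀ z, ‖z‖ ≤ K * N z) ∧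
      ∀ x z, N x ≤ ρ * N z + γ * (‖e x - a z‖ + ‖h x‖) := by
  let T : V →ₗ[ℂ] W × Z := e.prod h
  obtain ⟨G, hG⟩ := T.exists_leftInverse_of_injective (LinearMap.ker_eq_bot'.2 fun v hv => by
    have hv' := Prod.ext_iff.1 hv
    exact hdet 1 0 v (by simp) (by simp) (by simpa using (show e v = 0 from hv'.1)) hv'.2)
  have hGT : ∀ v, G (T v) = v := fun v => LinearMap.congr_fun hG v
  let A : V →ₗ[ℂ] W × Z := a.prod 0
  -- With `δ = T x - A z`, the equation `T x = A z + δ` splits into the dynamics `x = G A z + G δ`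
  -- and the constraint `D A z = -D δ`. So `D A` serves as an output that is small with `δ`.
  let D : W × Z →ₗ[ℂ] W × Z := LinearMap.id - T ∘ₗ G
  have hDT : ∀ v, D (T v) = 0 := fun v => by simp [D, hGT]
  obtain ⟨N, ⟨ρ, γ, hρ, hρ', hγ, hN⟩, K, hK, hNK⟩ := exists_norm_of_detectable (G ∘ₗ A) (D ∘ₗ A)
    (fun c v hc hF hC => by
      have h1 : A v = T (c • v) := by
        rw [← hF]
        exact sub_eq_zero.1 hC
      have h2 := Prod.ext_iff.1 h1
      have hc0 : c ≠ 0 := by rintro rfl; norm_num at hc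
      refine hdet c 1 v (by simp) (by simpa using hc) ?_ ?_
      · simpa [A, T] using h2.1.symm
      · simpa [A, T, hc0] using h2.2.symm)
  obtain ⟨L, hL, hLN⟩ := N.exists_le_norm
  let G' := LinearMap.toContinuousLinearMap G
  let D' := LinearMap.toContinuousLinearMap D
  refine ⟨N, ρ, L * ‖G'‖ + γ * ‖D'‖, K, hρ, hρ', by positivity, hK, hNK, fun x z => ?_⟩
  have hx : x = (G ∘ₗ A) z + G (T x - A z) := by rw [map_sub, hGT]; simp
  have hD : ‖(D ∘ₗ A) z‖ = ‖D (T x - A z)‖ := by rw [map_sub, hDT, zero_sub, norm_neg]; rfl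
  have hd : ‖T x - A z‖ ≤ ‖e x - a z‖ + ‖h x‖ := by
    rw [Prod.norm_def]
    refine max_le ?_ ?_
    · exact le_add_of_nonneg_right (norm_nonneg _)
    · simp [T, A]
  calc N x ≤ N ((G ∘ₗ A) z) + N (G (T x - A z)) := by
        conv_lhs => rw [hx]
        exact map_add_le_add N _ _
    _ ≤ (ρ * N z + γ * (‖D'‖ * ‖T x - A z‖)) + L * (‖G'‖ * ‖T x - A z‖) := by
        refine add_le_add ((hN z).trans ?_) ((hLN _).trans ?_)
        · gcongr
          rw [hD]
          exact D'.le_opNorm _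
        · gcongr
          exact G'.le_opNorm _
    _ = ρ * N z + (L * ‖G'‖ + γ * ‖D'‖) * ‖T x - A z‖ := by ring
    _ ≤ _ := by gcongr

end OutputContraction

/-! ### Coercivity and norm bounds for real matrices, in the sup norm. -/

namespace Matrix

variable {m n : ℕ}

lemma exists_norm_mulVec_le (M : Matrix (Fin m) (Fin n) ℝ) :
    ∃ K : ℝ, 0 ≤ K ∧ ∀ x, ‖M *ᵥ x‖ ≤ K * ‖x‖ :=
  ⟨_, norm_nonneg (LinearMap.toContinuousLinearMap M.mulVecLin),
    (LinearMap.toContinuousLinearMap M.mulVecLin).le_opNorm⟩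

lemma dotProduct_le_norm_mul_norm (x y : Fin n → ℝ) : x ⬝ᵥ y ≤ n * (‖x‖ * ‖y‖) := by
  calc x ⬝ᵥ y ≤ ∑ _i : Fin n, ‖x‖ * ‖y‖ := Finset.sum_le_sum fun i _ => by
        refine (le_abs_self _).trans ?_
        rw [abs_mul]
        exact mul_le_mul (norm_le_pi_norm x i) (norm_le_pi_norm y i) (abs_nonneg _) (norm_nonneg _)
    _ = n * (‖x‖ * ‖y‖) := by simp

lemma PosDef.exists_coercive {M : Matrix (Fin n) (Fin n) ℝ} (hM : M.PosDef) :
    ∃ c : ℝ, 0 < c ∧ ∀ x, c * ‖x‖ ^ 2 ≤ x ⬝ᵥ M *ᵥ x := by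
  have hcont : Continuous fun x : Fin n → ℝ => x ⬝ᵥ M *ᵥ x := by fun_prop
  rcases (Metric.sphere (0 : Fin n → ℝ) 1).eq_empty_or_nonempty with he | hne
  · refine ⟨1, one_pos, fun x => ?_⟩
    have hx : x = 0 := by
      by_contra hx
      have : ‖x‖⁻¹ • x ∈ Metric.sphere (0 : Fin n → ℝ) 1 := by
        simp [norm_smul, hx]
      rw [he] at this
      exact this
    simp [hx]
  · obtain ⟨x₀, hx₀, hmin⟩ := (isCompact_sphere (0 : Fin n → ℝ) 1).exists_isMinOn hne
      hcont.continuousOn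
    have hx₀' : x₀ ≠ 0 := by rintro rfl; simp at hx₀
    refine ⟨x₀ ⬝ᵥ M *ᵥ x₀, hM.dotProduct_mulVec_pos hx₀', fun x => ?_⟩
    rcases eq_or_ne x 0 with rfl | hx
    · simp
    have hx' : 0 < ‖x‖ := norm_pos_iff.2 hx
    have h1 : ‖x‖⁻¹ • x ∈ Metric.sphere (0 : Fin n → ℝ) 1 := by
      simp [norm_smul, hx]
    have h2 := isMinOn_iff.1 hmin _ h1
    simp only [mulVec_smul, smul_dotProduct, dotProduct_smul, smul_eq_mul] at h2
    calc _ ≤ ‖x‖⁻¹ * (‖x‖⁻¹ * x ⬝ᵥ M *ᵥ x) * ‖x‖ ^ 2 := by gcongr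
      _ = _ := by field_simp

lemma PosDef.mulVec_inv_mulVec {M : Matrix (Fin n) (Fin n) ℝ} (hM : M.PosDef) (x : Fin n → ℝ) :
    M *ᵥ M⁻¹ *ᵥ x = x := by
  rw [mulVec_mulVec, mul_nonsing_inv _ ((isUnit_iff_isUnit_det M).1 hM.isUnit), one_mulVec]

lemma PosDef.inv_mulVec_mulVec {M : Matrix (Fin n) (Fin n) ℝ} (hM : M.PosDef) (x : Fin n → ℝ) :
    M⁻¹ *ᵥ M *ᵥ x = x := by
  rw [mulVec_mulVec, nonsing_inv_mul _ ((isUnit_iff_isUnit_det M).1 hM.isUnit), one_mulVec]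

lemma PosDef.inv_inv {M : Matrix (Fin n) (Fin n) ℝ} (hM : M.PosDef) : M⁻¹⁻¹ = M :=
  nonsing_inv_nonsing_inv _ ((isUnit_iff_isUnit_det M).1 hM.isUnit)

end Matrix

lemma Complex.norm_ofReal_comp {n : ℕ} (x : Fin n → ℝ) : ‖fun i => (x i : ℂ)‖ = ‖x‖ := by
  simp [Pi.norm_def]

lemma Complex.map_ofReal_mulVec {m n : ℕ} (M : Matrix (Fin m) (Fin n) ℝ) (x : Fin n → ℝ) :
    (M.map Complex.ofReal).mulVec (fun i => (x i : ℂ)) = fun i => ((M.mulVec x i : ℝ) : ℂ) :=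
  funext fun i => (RingHom.map_mulVec Complex.ofRealHom M x i).symm

lemma le_of_mul_sq_le {c K a b : ℝ} (hc : 0 < c) (ha : 0 ≤ a) (hb : 0 ≤ b) (hK : 0 ≤ K)
    (h : c * a ^ 2 ≤ K * (a * b)) : a ≤ K / c * b := by
  rcases ha.eq_or_lt with rfl | ha
  · positivity
  · rw [div_mul_eq_mul_div, le_div_iff₀ hc]
    nlinarith

/-! ### Consequences of detectability; positive definiteness along the Riccati recursion. -/

namespace DescriptorSystem

open Matrix

variable {n n₁ q m : ℕ} {S : DescriptorSystem n n₁ q m}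

lemma Detectable.eq_zero (hdet : S.Detectable) {μ φ : ℂ} (h0 : (μ, φ) ≠ (0, 0)) (hle : ‖φ‖ ≤ ‖μ‖)
    {v : Fin n → ℂ} (hv : S.pencil μ φ *ᵥ v = 0) (hH : S.H.map Complex.ofReal *ᵥ v = 0) :
    v = 0 := by
  have hr := hdet μ φ h0 hle
  set M := Matrix.fromRows (S.pencil μ φ) (S.H.map Complex.ofReal) with hM
  have h1 := M.mulVecLin.finrank_range_add_finrank_ker
  have h2 : Module.finrank ℂ M.mulVecLin.ker = 0 := by
    have : M.rank = Module.finrank ℂ M.mulVecLin.range := rfl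
    simp only [Module.finrank_fintype_fun_eq_card, Fintype.card_fin] at h1
    omega
  have h3 : M.mulVecLin v = 0 := by
    rw [Matrix.mulVecLin_apply, hM, Matrix.fromRows_mulVec, hv, hH]
    ext i
    rcases i with i | i <;> rfl
  have h4 := Submodule.finrank_eq_zero.1 h2
  exact LinearMap.ker_eq_bot'.1 h4 v h3

/-- Detectability yields a norm, contracted along the undisturbed and unobserved trajectories. -/
lemma Detectable.exists_norm (hdet : S.Detectable) :
    ∃ (N : (Fin n → ℝ) → ℝ) (ρ γ K : ℝ), 0 ≤ ρ ∧ ρ < 1 ∧ 0 ≤ γ ∧ 0 ≤ K ∧ N 0 = 0 ∧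
      (∀ z, 0 ≤ N z) ∧ (∀ z, ‖z‖ ≤ K * N z) ∧
      ∀ x z, N x ≤ ρ * N z + γ * (‖S.E *ᵥ x - S.A *ᵥ z‖ + ‖S.H *ᵥ x‖) := by
  obtain ⟨N, ρ, γ, K, hρ, hρ', hγ, hK, hNK, hN⟩ :=
    OutputContraction.exists_norm_of_detectable_pencil (S.E.map Complex.ofReal).mulVecLin
      (S.A.map Complex.ofReal).mulVecLin (S.H.map Complex.ofReal).mulVecLin
      (fun μ φ v h0 hle hv hH => hdet.eq_zero h0 hle (by
        rw [pencil, sub_mulVec, smul_mulVec, smul_mulVec, sub_eq_zero]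
        exact hv) hH)
  refine ⟨fun x => N fun i => (x i : ℂ), ρ, γ, K, hρ, hρ', hγ, hK, ?_, fun z => apply_nonneg N _,
    fun z => ?_, fun x z => ?_⟩
  · exact (congrArg N (funext fun i => Complex.ofReal_zero)).trans (map_zero N)
  · rw [← Complex.norm_ofReal_comp]
    exact hNK _
  · have h := hN (fun i => (x i : ℂ)) fun i => (z i : ℂ)
    simp only [mulVecLin_apply, Complex.map_ofReal_mulVec] at h
    rw [Complex.norm_ofReal_comp] at h
    rw [← Complex.norm_ofReal_comp (S.E *ᵥ x - S.A *ᵥ z)]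
    have hsub : (fun i => (((S.E *ᵥ x - S.A *ᵥ z) i : ℝ) : ℂ))
        = (fun i => (((S.E *ᵥ x) i : ℝ) : ℂ)) - fun i => (((S.A *ᵥ z) i : ℝ) : ℂ) := by
      ext i
      simp
    rw [hsub]
    exact h

/-- Take `z = 0` in the contraction estimate. This joint injectivity of `E` and `H` makes the
inverses in the recursion genuine. -/
lemma Detectable.eq_zero_of_mulVec_eq_zero (hdet : S.Detectable) {x : Fin n → ℝ}
    (hE : S.E *ᵥ x = 0) (hH : S.H *ᵥ x = 0) : x = 0 := by
  obtain ⟨N, ρ, γ, K, -, -, -, hK, h0, -, hNK, hN⟩ := hdet.exists_norm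
  have h1 := hN x 0
  rw [h0, hE, hH] at h1
  simp only [mulVec_zero, sub_zero, norm_zero, add_zero, mul_zero] at h1
  exact norm_le_zero_iff.1 ((hNK x).trans (mul_nonpos_of_nonneg_of_nonpos hK h1))

section Recursion

variable {Q : Matrix (Fin n₁) (Fin n₁) ℝ} {R : Matrix (Fin m) (Fin m) ℝ}
  {P₀ P : Matrix (Fin n) (Fin n) ℝ}

lemma covMinus_posDef (hQ : Q.PosDef) (hP : P.PosDef) : (S.covMinus Q P).PosDef := by
  rw [covMinus, add_comm]
  exact hQ.add_posSemidef (by simpa using hP.posSemidef.mul_mul_conjTranspose_same S.A)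

lemma information_posDef (hdet : S.Detectable) (hR : R.PosDef) {D : Matrix (Fin n₁) (Fin n₁) ℝ}
    (hD : D.PosDef) :
    (S.E.transpose * D⁻¹ * S.E + S.H.transpose * R⁻¹ * S.H).PosDef := by
  have h1 : (S.E.transpose * D⁻¹ * S.E).PosSemidef := by
    simpa using hD.inv.posSemidef.conjTranspose_mul_mul_same S.E
  have h2 : (S.H.transpose * R⁻¹ * S.H).PosSemidef := by
    simpa using hR.inv.posSemidef.conjTranspose_mul_mul_same S.H
  refine PosDef.of_dotProduct_mulVec_pos (h1.isHermitian.add h2.isHermitian) fun x hx => ?_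
  have key : star x ⬝ᵥ (S.E.transpose * D⁻¹ * S.E + S.H.transpose * R⁻¹ * S.H) *ᵥ x
      = (S.E *ᵥ x) ⬝ᵥ D⁻¹ *ᵥ (S.E *ᵥ x) + (S.H *ᵥ x) ⬝ᵥ R⁻¹ *ᵥ (S.H *ᵥ x) := by
    simp only [star_trivial, add_mulVec, ← mulVec_mulVec, dotProduct_add]
    rw [dotProduct_mulVec x, dotProduct_mulVec x, vecMul_transpose, vecMul_transpose]
  rw [key]
  have hE0 := hD.inv.posSemidef.dotProduct_mulVec_nonneg (S.E *ᵥ x)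
  have hH0 := hR.inv.posSemidef.dotProduct_mulVec_nonneg (S.H *ᵥ x)
  rw [star_trivial] at hE0 hH0
  by_cases hE : S.E *ᵥ x = 0
  · have hH : S.H *ᵥ x ≠ 0 := fun hH => hx (hdet.eq_zero_of_mulVec_eq_zero hE hH)
    exact add_pos_of_nonneg_of_pos hE0 (by simpa using hR.inv.dotProduct_mulVec_pos hH)
  · exact add_pos_of_pos_of_nonneg (by simpa using hD.inv.dotProduct_mulVec_pos hE) hH0

lemma covPlus_posDef (hdet : S.Detectable) (hQ : Q.PosDef) (hR : R.PosDef) (hP₀ : P₀.PosDef)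
    (k : ℕ) : (S.covPlus Q R P₀ k).PosDef := by
  induction k with
  | zero => exact hP₀
  | succ k ih => exact (information_posDef hdet hR (covMinus_posDef hQ ih)).inv

end Recursion

end DescriptorSystem

/-! ### The energy balance of a smoother step. -/

noncomputable section

namespace DescriptorSystem

open Matrix

variable {n n₁ q m : ℕ} {S : DescriptorSystem n n₁ q m}
  {Q : Matrix (Fin n₁) (Fin n₁) ℝ} {R : Matrix (Fin m) (Fin m) ℝ} {P₀ : Matrix (Fin n) (Fin n) ℝ}

variable (S Q R P₀) in
/-- The factor `Γ_k Aᵀ Q⁻¹ E` of the coupling matrices. -/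
def couplingFactor (k : ℕ) : Matrix (Fin n) (Fin n) ℝ :=
  S.smoothCov Q R P₀ k * S.A.transpose * Q⁻¹ * S.E

variable (S Q R P₀) in
/-- The quadratic form of the information matrix `(P_k⁽⁺⁾)⁻¹`. -/
def energy (k : ℕ) (x : Fin n → ℝ) : ℝ := x ⬝ᵥ (S.covPlus Q R P₀ k)⁻¹ *ᵥ x

variable (S Q R P₀) in
/-- The weighted process residual of the smoother step that ends in `x`. -/
def residual (k : ℕ) (x : Fin n → ℝ) : Fin n₁ → ℝ :=
  Q⁻¹ *ᵥ (S.E *ᵥ x - S.A *ᵥ (S.couplingFactor Q R P₀ k *ᵥ x))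

lemma smoothCov_inv (hdet : S.Detectable) (hQ : Q.PosDef) (hR : R.PosDef) (hP₀ : P₀.PosDef)
    (k : ℕ) : (S.smoothCov Q R P₀ k)⁻¹ =
      (S.covPlus Q R P₀ k)⁻¹ + S.A.transpose * Q⁻¹ * S.A := by
  have h : (S.A.transpose * Q⁻¹ * S.A).PosSemidef := by
    simpa using hQ.inv.posSemidef.conjTranspose_mul_mul_same S.A
  exact ((covPlus_posDef hdet hQ hR hP₀ k).inv.add_posSemidef h).inv_inv

/-- The normal equation of the minimization over the previous state. -/
lemma covPlus_inv_mulVec_couplingFactor (hdet : S.Detectable) (hQ : Q.PosDef) (hR : R.PosDef)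
    (hP₀ : P₀.PosDef) (k : ℕ) (x : Fin n → ℝ) :
    (S.covPlus Q R P₀ k)⁻¹ *ᵥ (S.couplingFactor Q R P₀ k *ᵥ x)
      = S.A.transpose *ᵥ S.residual Q R P₀ k x := by
  have h : (S.A.transpose * Q⁻¹ * S.A).PosSemidef := by
    simpa using hQ.inv.posSemidef.conjTranspose_mul_mul_same S.A
  have hpd := (covPlus_posDef hdet hQ hR hP₀ k).inv.add_posSemidef h
  have h1 : ((S.covPlus Q R P₀ k)⁻¹ + S.A.transpose * Q⁻¹ * S.A) *ᵥ
      (S.couplingFactor Q R P₀ k *ᵥ x) = S.A.transpose *ᵥ Q⁻¹ *ᵥ S.E *ᵥ x := by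
    rw [couplingFactor, smoothCov, ← mulVec_mulVec, ← mulVec_mulVec, ← mulVec_mulVec]
    exact hpd.mulVec_inv_mulVec _
  rw [add_mulVec, ← mulVec_mulVec, ← mulVec_mulVec] at h1
  rw [residual, mulVec_sub, mulVec_sub, ← h1, add_sub_cancel_right]

lemma mulVec_residual (hQ : Q.PosDef) (k : ℕ) (x : Fin n → ℝ) :
    Q *ᵥ S.residual Q R P₀ k x = S.E *ᵥ x - S.A *ᵥ (S.couplingFactor Q R P₀ k *ᵥ x) :=
  hQ.mulVec_inv_mulVec _

/-- By the normal equation, `A P Aᵀ s = A z`, while `Q s = E x - A z`. This identifies `s` with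
`(P⁽⁻⁾)⁻¹ E x` without a matrix inversion lemma. -/
lemma covMinus_mulVec_residual (hdet : S.Detectable) (hQ : Q.PosDef) (hR : R.PosDef)
    (hP₀ : P₀.PosDef) (k : ℕ) (x : Fin n → ℝ) :
    S.covMinus Q (S.covPlus Q R P₀ k) *ᵥ S.residual Q R P₀ k x = S.E *ᵥ x := by
  rw [covMinus, add_mulVec, ← mulVec_mulVec, ← mulVec_mulVec, mulVec_residual hQ,
    ← covPlus_inv_mulVec_couplingFactor hdet hQ hR hP₀,
    (covPlus_posDef hdet hQ hR hP₀ k).mulVec_inv_mulVec, add_sub_cancel]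

lemma covPlus_succ_inv_mulVec (hdet : S.Detectable) (hQ : Q.PosDef) (hR : R.PosDef)
    (hP₀ : P₀.PosDef) (k : ℕ) (x : Fin n → ℝ) :
    (S.covPlus Q R P₀ (k + 1))⁻¹ *ᵥ x
      = S.E.transpose *ᵥ S.residual Q R P₀ k x + S.H.transpose *ᵥ R⁻¹ *ᵥ S.H *ᵥ x := by
  have hD := covMinus_posDef (S := S) hQ (covPlus_posDef hdet hQ hR hP₀ k)
  rw [covPlus, (information_posDef hdet hR hD).inv_inv, add_mulVec, ← mulVec_mulVec,
    ← mulVec_mulVec, ← mulVec_mulVec, ← mulVec_mulVec]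
  nth_rewrite 1 [← covMinus_mulVec_residual hdet hQ hR hP₀ k x]
  rw [hD.inv_mulVec_mulVec]

lemma energy_nonneg (hdet : S.Detectable) (hQ : Q.PosDef) (hR : R.PosDef) (hP₀ : P₀.PosDef)
    (k : ℕ) (x : Fin n → ℝ) : 0 ≤ S.energy Q R P₀ k x := by
  simpa [energy] using
    (covPlus_posDef hdet hQ hR hP₀ k).inv.posSemidef.dotProduct_mulVec_nonneg x

lemma energy_couplingFactor (hdet : S.Detectable) (hQ : Q.PosDef) (hR : R.PosDef)
    (hP₀ : P₀.PosDef) (k : ℕ) (x : Fin n → ℝ) :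
    S.energy Q R P₀ k (S.couplingFactor Q R P₀ k *ᵥ x)
      = (S.A *ᵥ (S.couplingFactor Q R P₀ k *ᵥ x)) ⬝ᵥ S.residual Q R P₀ k x := by
  rw [energy, covPlus_inv_mulVec_couplingFactor hdet hQ hR hP₀, dotProduct_mulVec,
    vecMul_transpose]

lemma energy_succ_eq (hdet : S.Detectable) (hQ : Q.PosDef) (hR : R.PosDef)
    (hP₀ : P₀.PosDef) (k : ℕ) (x : Fin n → ℝ) :
    S.energy Q R P₀ (k + 1) x = (S.E *ᵥ x) ⬝ᵥ S.residual Q R P₀ k x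
      + (S.H *ᵥ x) ⬝ᵥ R⁻¹ *ᵥ (S.H *ᵥ x) := by
  rw [energy, covPlus_succ_inv_mulVec hdet hQ hR hP₀, dotProduct_add, dotProduct_mulVec x,
    dotProduct_mulVec x, vecMul_transpose, vecMul_transpose]

/-- The energy balance of one smoother step. -/
lemma energy_succ (hdet : S.Detectable) (hQ : Q.PosDef) (hR : R.PosDef)
    (hP₀ : P₀.PosDef) (k : ℕ) (x : Fin n → ℝ) :
    S.energy Q R P₀ (k + 1) x = S.energy Q R P₀ k (S.couplingFactor Q R P₀ k *ᵥ x)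
      + S.residual Q R P₀ k x ⬝ᵥ Q *ᵥ S.residual Q R P₀ k x
      + (S.H *ᵥ x) ⬝ᵥ R⁻¹ *ᵥ (S.H *ᵥ x) := by
  rw [energy_succ_eq hdet hQ hR hP₀, energy_couplingFactor hdet hQ hR hP₀, mulVec_residual hQ,
    dotProduct_comm (S.residual Q R P₀ k x), sub_dotProduct]
  ring

/-! ### Bounds uniform in time, and contraction of the energy. -/

/-- Detectability bounds the information matrices uniformly from below. -/
lemma exists_le_energy (hdet : S.Detectable) (hQ : Q.PosDef) (hR : R.PosDef) (hP₀ : P₀.PosDef) :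
    ∃ c : ℝ, 0 < c ∧ ∀ k x, c * ‖x‖ ^ 2 ≤ S.energy Q R P₀ k x := by
  obtain ⟨N, ρ, γ, K, hρ, hρ', hγ, hK, hN0, hNn, hNK, hN⟩ := hdet.exists_norm
  obtain ⟨c₀, hc₀, hP⟩ := hP₀.inv.exists_coercive
  obtain ⟨cQ, hcQ, hQc⟩ := hQ.inv.exists_coercive
  obtain ⟨cR, hcR, hRc⟩ := hR.inv.exists_coercive
  obtain ⟨KE, hKE, hE⟩ := S.E.exists_norm_mulVec_le
  obtain ⟨KH, hKH, hH⟩ := S.H.exists_norm_mulVec_le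
  set L := γ * (KE + KH) with hL
  have hL0 : 0 ≤ L := by positivity
  have hNL : ∀ x, N x ≤ L * ‖x‖ := fun x => by
    have h := hN x 0
    rw [hN0, mulVec_zero, sub_zero, mul_zero, zero_add] at h
    calc N x ≤ γ * (KE * ‖x‖ + KH * ‖x‖) := h.trans (by gcongr; exacts [hE x, hH x])
      _ = L * ‖x‖ := by rw [hL]; ring
  have hρ2 : 0 < 1 - ρ ^ 2 := by nlinarith
  -- From `(ρ a + β)² ≤ a² + β² / (1 - ρ²)` with `β = γ (d + h)`, and `(d + h)² ≤ 2 (d² + h²)`.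
  set C := 2 * γ ^ 2 / (1 - ρ ^ 2) with hC
  have hC0 : 0 ≤ C := by positivity
  have hsq : ∀ x z, N x ^ 2 ≤ N z ^ 2 + C * (‖S.E *ᵥ x - S.A *ᵥ z‖ ^ 2 + ‖S.H *ᵥ x‖ ^ 2) := by
    intro x z
    set a := N z
    set d := ‖S.E *ᵥ x - S.A *ᵥ z‖
    set h := ‖S.H *ᵥ x‖
    have h1 : N x ^ 2 ≤ (ρ * a + γ * (d + h)) ^ 2 := pow_le_pow_left₀ (hNn x) (hN x z) 2
    have h2 : C * (1 - ρ ^ 2) = 2 * γ ^ 2 := by rw [hC]; field_simp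
    have h3 : (1 - ρ ^ 2) * (ρ * a + γ * (d + h)) ^ 2
        ≤ (1 - ρ ^ 2) * (a ^ 2 + C * (d ^ 2 + h ^ 2)) := by
      have : (1 - ρ ^ 2) * (a ^ 2 + C * (d ^ 2 + h ^ 2))
          = (1 - ρ ^ 2) * a ^ 2 + 2 * γ ^ 2 * (d ^ 2 + h ^ 2) := by rw [← h2]; ring
      rw [this]
      nlinarith [sq_nonneg ((1 - ρ ^ 2) * a - ρ * (γ * (d + h))), sq_nonneg (γ * (d - h))]
    exact h1.trans (le_of_mul_le_mul_left h3 hρ2)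
  -- The first bound on `c` starts the induction at `P₀`; the other two let the process and output
  -- costs pay for the growth of `c N²`.
  obtain ⟨c, hc, h1, h2, h3⟩ : ∃ c : ℝ, 0 < c ∧ c * L ^ 2 ≤ c₀ ∧ c * C ≤ cQ ∧ c * C ≤ cR := by
    refine ⟨min (c₀ / (L ^ 2 + 1)) (min (cQ / (C + 1)) (cR / (C + 1))), by positivity, ?_, ?_, ?_⟩
    · calc _ ≤ c₀ / (L ^ 2 + 1) * (L ^ 2 + 1) := by
            gcongr
            · exact min_le_left _ _
            · linarith
        _ = c₀ := by field_simp
    · calc _ ≤ cQ / (C + 1) * (C + 1) := by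
            gcongr
            · exact (min_le_right _ _).trans (min_le_left _ _)
            · linarith
        _ = cQ := by field_simp
    · calc _ ≤ cR / (C + 1) * (C + 1) := by
            gcongr
            · exact (min_le_right _ _).trans (min_le_right _ _)
            · linarith
        _ = cR := by field_simp
  have main : ∀ k x, c * N x ^ 2 ≤ S.energy Q R P₀ k x := by
    intro k
    induction k with
    | zero =>
      intro x
      calc c * N x ^ 2 ≤ c * (L * ‖x‖) ^ 2 := by gcongr; exacts [hNn x, hNL x]
        _ = c * L ^ 2 * ‖x‖ ^ 2 := by ring
        _ ≤ c₀ * ‖x‖ ^ 2 := by gcongr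
        _ ≤ _ := hP x
    | succ k ih =>
      intro x
      set z := S.couplingFactor Q R P₀ k *ᵥ x with hz
      have hcost : cQ * ‖S.E *ᵥ x - S.A *ᵥ z‖ ^ 2
          ≤ S.residual Q R P₀ k x ⬝ᵥ Q *ᵥ S.residual Q R P₀ k x := by
        rw [mulVec_residual hQ, dotProduct_comm]
        exact hQc _
      rw [energy_succ hdet hQ hR hP₀, ← hz]
      calc c * N x ^ 2 ≤ c * (N z ^ 2 + C * (‖S.E *ᵥ x - S.A *ᵥ z‖ ^ 2 + ‖S.H *ᵥ x‖ ^ 2)) := by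
            gcongr
            exact hsq x z
        _ = c * N z ^ 2 + c * C * ‖S.E *ᵥ x - S.A *ᵥ z‖ ^ 2 + c * C * ‖S.H *ᵥ x‖ ^ 2 := by ring
        _ ≤ c * N z ^ 2 + cQ * ‖S.E *ᵥ x - S.A *ᵥ z‖ ^ 2 + cR * ‖S.H *ᵥ x‖ ^ 2 := by gcongr
        _ ≤ _ := add_le_add (add_le_add (ih z) hcost) (hRc _)
  refine ⟨c / (K ^ 2 + 1), by positivity, fun k x => le_trans ?_ (main k x)⟩
  calc c / (K ^ 2 + 1) * ‖x‖ ^ 2 ≤ c / (K ^ 2 + 1) * ((K ^ 2 + 1) * N x ^ 2) := by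
        gcongr
        have := pow_le_pow_left₀ (norm_nonneg x) (hNK x) 2
        nlinarith [sq_nonneg (N x)]
    _ = c * N x ^ 2 := by field_simp

/-- Every smoother step dissipates a uniform fraction of the squared norm. -/
lemma exists_dissipation (hdet : S.Detectable) (hQ : Q.PosDef) (hR : R.PosDef)
    (hP₀ : P₀.PosDef) : ∃ ε : ℝ, 0 < ε ∧ ∀ k x,
      S.energy Q R P₀ k (S.couplingFactor Q R P₀ k *ᵥ x) + ε * ‖x‖ ^ 2
        ≤ S.energy Q R P₀ (k + 1) x := by
  obtain ⟨c, hc, hcx⟩ := exists_le_energy hdet hQ hR hP₀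
  obtain ⟨N, ρ, γ, K, hρ, hρ', hγ, hK, hN0, hNn, hNK, hN⟩ := hdet.exists_norm
  obtain ⟨cQ, hcQ, hQc⟩ := hQ.exists_coercive
  obtain ⟨cR, hcR, hRc⟩ := hR.inv.exists_coercive
  obtain ⟨KQ, hKQ, hQK⟩ := Q.exists_norm_mulVec_le
  obtain ⟨KA, hKA, hA⟩ := S.A.exists_norm_mulVec_le
  set D := K * γ * (KA * (n₁ * KA / c) + KQ + 1) with hD
  have hD0 : 0 ≤ D := by positivity
  -- The lower energy bound and `V_k(z) = (A z) ⬝ᵥ s` bound `z` by `s`; then `E x = A z + Q s` is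
  -- bounded by `s`, and the contraction estimate against the zero state recovers `x` from `E x` and
  -- `H x`.
  have hx : ∀ k x, ‖x‖ ≤ D * (‖S.residual Q R P₀ k x‖ + ‖S.H *ᵥ x‖) := by
    intro k x
    set s := S.residual Q R P₀ k x with hs
    set z := S.couplingFactor Q R P₀ k *ᵥ x with hz
    have hzs : ‖z‖ ≤ n₁ * KA / c * ‖s‖ := by
      refine le_of_mul_sq_le hc (norm_nonneg _) (norm_nonneg _) (by positivity) ?_
      calc c * ‖z‖ ^ 2 ≤ (S.A *ᵥ z) ⬝ᵥ s :=
            (hcx k z).trans_eq (energy_couplingFactor hdet hQ hR hP₀ k x)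
        _ ≤ n₁ * (‖S.A *ᵥ z‖ * ‖s‖) := dotProduct_le_norm_mul_norm _ _
        _ ≤ n₁ * (KA * ‖z‖ * ‖s‖) := by gcongr; exact hA z
        _ = _ := by ring
    have hEx : ‖S.E *ᵥ x‖ ≤ (KA * (n₁ * KA / c) + KQ) * ‖s‖ := by
      have : S.E *ᵥ x = S.A *ᵥ z + Q *ᵥ s := by rw [hs, mulVec_residual hQ, ← hz, add_sub_cancel]
      rw [this]
      calc _ ≤ ‖S.A *ᵥ z‖ + ‖Q *ᵥ s‖ := norm_add_le _ _
        _ ≤ KA * (n₁ * KA / c * ‖s‖) + KQ * ‖s‖ := by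
            refine add_le_add ((hA z).trans ?_) (hQK s)
            gcongr
        _ = _ := by ring
    have h1 := hN x 0
    rw [hN0, mulVec_zero, sub_zero, mul_zero, zero_add] at h1
    calc ‖x‖ ≤ K * (γ * ((KA * (n₁ * KA / c) + KQ) * ‖s‖ + ‖S.H *ᵥ x‖)) :=
          (hNK x).trans (by gcongr; exact h1.trans (by gcongr))
      _ = K * γ * ((KA * (n₁ * KA / c) + KQ) * ‖s‖ + 1 * ‖S.H *ᵥ x‖) := by ring
      _ ≤ K * γ * ((KA * (n₁ * KA / c) + KQ + 1) * ‖s‖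
            + (KA * (n₁ * KA / c) + KQ + 1) * ‖S.H *ᵥ x‖) := by
          have hB : 0 ≤ KA * (n₁ * KA / c) + KQ := by positivity
          refine mul_le_mul_of_nonneg_left (add_le_add ?_ ?_) (by positivity)
          · exact mul_le_mul_of_nonneg_right (by linarith) (norm_nonneg _)
          · exact mul_le_mul_of_nonneg_right (by linarith) (norm_nonneg _)
      _ = _ := by rw [hD]; ring
  refine ⟨min cQ cR / (2 * D ^ 2 + 1), by positivity, fun k x => ?_⟩
  set s := S.residual Q R P₀ k x with hs
  rw [energy_succ hdet hQ hR hP₀, add_assoc, ← hs]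
  gcongr
  calc min cQ cR / (2 * D ^ 2 + 1) * ‖x‖ ^ 2
      ≤ min cQ cR / (2 * D ^ 2 + 1) * ((2 * D ^ 2 + 1) * (‖s‖ ^ 2 + ‖S.H *ᵥ x‖ ^ 2)) := by
        gcongr
        have := pow_le_pow_left₀ (norm_nonneg x) (hx k x) 2
        nlinarith [sq_nonneg (D * (‖s‖ - ‖S.H *ᵥ x‖)), sq_nonneg ‖s‖, sq_nonneg ‖S.H *ᵥ x‖]
    _ = min cQ cR * ‖s‖ ^ 2 + min cQ cR * ‖S.H *ᵥ x‖ ^ 2 := by field_simp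
    _ ≤ cQ * ‖s‖ ^ 2 + cR * ‖S.H *ᵥ x‖ ^ 2 := by
        gcongr
        · exact min_le_left _ _
        · exact min_le_right _ _
    _ ≤ _ := add_le_add (hQc s) (hRc _)

/-- The information matrices `(P_k⁽⁺⁾)⁻¹` with `k ≥ 1` are uniformly bounded. -/
lemma exists_norm_covPlus_inv_le (hdet : S.Detectable) (hQ : Q.PosDef) (hR : R.PosDef)
    (hP₀ : P₀.PosDef) : ∃ L : ℝ, 0 ≤ L ∧ ∀ k x,
      ‖(S.covPlus Q R P₀ (k + 1))⁻¹ *ᵥ x‖ ≤ L * ‖x‖ := by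
  obtain ⟨cQ, hcQ, hQc⟩ := hQ.exists_coercive
  obtain ⟨KE, hKE, hE⟩ := S.E.exists_norm_mulVec_le
  obtain ⟨KT, hKT, hT⟩ := S.E.transpose.exists_norm_mulVec_le
  obtain ⟨KH, hKH, hH⟩ := (S.H.transpose * R⁻¹ * S.H).exists_norm_mulVec_le
  refine ⟨KT * (n₁ * KE / cQ) + KH, by positivity, fun k x => ?_⟩
  set s := S.residual Q R P₀ k x with hs
  -- Comparing the two formulas for `V_{k+1}(x)` gives `sᵀ Q s ≤ (E x) ⬝ᵥ s`, whatever `P_k⁽⁺⁾` is.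
  have hsx : ‖s‖ ≤ n₁ * KE / cQ * ‖x‖ := by
    refine le_of_mul_sq_le hcQ (norm_nonneg _) (norm_nonneg _) (by positivity) ?_
    have h1 := energy_succ hdet hQ hR hP₀ k x
    rw [energy_succ_eq hdet hQ hR hP₀, ← hs] at h1
    have h2 := energy_nonneg hdet hQ hR hP₀ k (S.couplingFactor Q R P₀ k *ᵥ x)
    calc cQ * ‖s‖ ^ 2 ≤ (S.E *ᵥ x) ⬝ᵥ s := by linarith [hQc s]
      _ ≤ n₁ * (‖S.E *ᵥ x‖ * ‖s‖) := dotProduct_le_norm_mul_norm _ _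
      _ ≤ n₁ * (KE * ‖x‖ * ‖s‖) := by gcongr; exact hE x
      _ = _ := by ring
  rw [covPlus_succ_inv_mulVec hdet hQ hR hP₀, ← hs]
  calc _ ≤ ‖S.E.transpose *ᵥ s‖ + ‖S.H.transpose *ᵥ R⁻¹ *ᵥ S.H *ᵥ x‖ := norm_add_le _ _
    _ ≤ KT * (n₁ * KE / cQ * ‖x‖) + KH * ‖x‖ := by
        refine add_le_add ((hT s).trans (by gcongr)) ?_
        have := hH x
        rwa [← mulVec_mulVec, ← mulVec_mulVec] at this
    _ = _ := by ring

/-- The smoother steps contract the energy at a uniform rate. -/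
lemma exists_energy_contraction (hdet : S.Detectable) (hQ : Q.PosDef) (hR : R.PosDef)
    (hP₀ : P₀.PosDef) : ∃ r : ℝ, 0 ≤ r ∧ r < 1 ∧ ∀ k x,
      S.energy Q R P₀ k (S.couplingFactor Q R P₀ k *ᵥ x) ≤ r * S.energy Q R P₀ (k + 1) x := by
  obtain ⟨ε, hε, hd⟩ := exists_dissipation hdet hQ hR hP₀
  obtain ⟨L, hL, hLx⟩ := exists_norm_covPlus_inv_le hdet hQ hR hP₀
  -- The added `ε` keeps the denominator positive when `n * L = 0` and the rate nonnegative.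
  have h0 : 0 < n * L + ε := by positivity
  refine ⟨1 - ε / (n * L + ε), ?_, ?_, fun k x => ?_⟩
  · rw [sub_nonneg, div_le_one h0]
    have : 0 ≤ n * L := by positivity
    linarith
  · have : 0 < ε / (n * L + ε) := by positivity
    linarith
  · have h1 : S.energy Q R P₀ (k + 1) x ≤ (n * L + ε) * ‖x‖ ^ 2 := by
      calc _ ≤ n * (‖x‖ * ‖(S.covPlus Q R P₀ (k + 1))⁻¹ *ᵥ x‖) := dotProduct_le_norm_mul_norm _ _
        _ ≤ n * (‖x‖ * (L * ‖x‖)) := by gcongr; exact hLx k x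
        _ = n * L * ‖x‖ ^ 2 := by ring
        _ ≤ _ := by gcongr; linarith
    have h2 : ε / (n * L + ε) * S.energy Q R P₀ (k + 1) x ≤ ε * ‖x‖ ^ 2 := by
      rw [div_mul_eq_mul_div, div_le_iff₀ h0]
      nlinarith
    nlinarith [hd k x]

lemma energy_couplingMatrix_le {r : ℝ} (hr : 0 ≤ r)
    (h : ∀ k x, S.energy Q R P₀ k (S.couplingFactor Q R P₀ k *ᵥ x)
      ≤ r * S.energy Q R P₀ (k + 1) x) (b i : ℕ) (x : Fin n → ℝ) :
    S.energy Q R P₀ (b + 1) (S.couplingMatrix Q R P₀ b (i + 1) *ᵥ x)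
      ≤ r ^ i * S.energy Q R P₀ (b + (i + 1)) x := by
  induction i generalizing x with
  | zero => simp [couplingMatrix]
  | succ i ih =>
    have h1 : S.couplingMatrix Q R P₀ b (i + 1 + 1) *ᵥ x
        = S.couplingMatrix Q R P₀ b (i + 1) *ᵥ (S.couplingFactor Q R P₀ (b + (i + 1)) *ᵥ x) := by
      rw [mulVec_mulVec]
      rfl
    rw [h1]
    calc _ ≤ r ^ i * (r * S.energy Q R P₀ (b + (i + 1) + 1) x) :=
          (ih _).trans (by gcongr; exact h _ x)
      _ = _ := by rw [pow_succ, mul_assoc]; rfl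

/-- The two-sided energy bounds convert the energy decay into decay of squared norms. -/
lemma exists_norm_sq_mul_couplingMatrix_le (hdet : S.Detectable) (hQ : Q.PosDef) (hR : R.PosDef)
    (hP₀ : P₀.PosDef) : ∃ K r : ℝ, 0 ≤ K ∧ 0 ≤ r ∧ r < 1 ∧ ∀ b i x,
      ‖((S.smoothCov Q R P₀ (b + 1))⁻¹ * S.couplingMatrix Q R P₀ b (i + 1)) *ᵥ x‖ ^ 2
        ≤ K * r ^ i * ‖x‖ ^ 2 := by
  obtain ⟨c, hc, hcx⟩ := exists_le_energy hdet hQ hR hP₀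
  obtain ⟨L, hL, hLx⟩ := exists_norm_covPlus_inv_le hdet hQ hR hP₀
  obtain ⟨r, hr, hr', hrx⟩ := exists_energy_contraction hdet hQ hR hP₀
  obtain ⟨KA, hKA, hA⟩ := (S.A.transpose * Q⁻¹ * S.A).exists_norm_mulVec_le
  refine ⟨(L + KA) ^ 2 * (n * L / c), r, by positivity, hr, hr', fun b i x => ?_⟩
  set y := S.couplingMatrix Q R P₀ b (i + 1) *ᵥ x with hy
  have h1 : ‖(S.smoothCov Q R P₀ (b + 1))⁻¹ *ᵥ y‖ ≤ (L + KA) * ‖y‖ := by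
    rw [smoothCov_inv hdet hQ hR hP₀, add_mulVec, add_mul]
    exact (norm_add_le _ _).trans (add_le_add (hLx b y) (hA y))
  have h2 : ‖y‖ ^ 2 ≤ n * L / c * r ^ i * ‖x‖ ^ 2 := by
    rw [div_mul_eq_mul_div, div_mul_eq_mul_div, le_div_iff₀ hc, mul_comm _ c]
    calc c * ‖y‖ ^ 2 ≤ r ^ i * S.energy Q R P₀ (b + (i + 1)) x :=
          (hcx (b + 1) y).trans (energy_couplingMatrix_le hr hrx b i x)
      _ ≤ r ^ i * (n * (‖x‖ * (L * ‖x‖))) := by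
          gcongr
          refine (dotProduct_le_norm_mul_norm _ _).trans ?_
          gcongr
          exact hLx (b + i) x
      _ = _ := by ring
  rw [← mulVec_mulVec, ← hy]
  calc _ ≤ ((L + KA) * ‖y‖) ^ 2 := by gcongr
    _ = (L + KA) ^ 2 * ‖y‖ ^ 2 := by ring
    _ ≤ (L + KA) ^ 2 * (n * L / c * r ^ i * ‖x‖ ^ 2) := by gcongr
    _ = _ := by ring

end DescriptorSystem

/-! ### Passage to the induced norm and the limit. -/

lemma continuous_inducedTwoNorm {n : ℕ} :
    Continuous (inducedTwoNorm : Matrix (Fin n) (Fin n) ℝ → ℝ) :=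
  continuous_norm.comp (LinearMap.continuous_of_finiteDimensional
    (Matrix.toEuclideanCLM (n := Fin n) (𝕜 := ℝ)).toAlgEquiv.toLinearMap)

end

theorem mainTheorem1 {n n₁ q m : ℕ} (S : DescriptorSystem n n₁ q m)
    (Q : Matrix (Fin n₁) (Fin n₁) ℝ) (R : Matrix (Fin m) (Fin m) ℝ)
    (P₀ : Matrix (Fin n) (Fin n) ℝ)
    (hQ : Q.PosDef) (hR : R.PosDef) (hP₀ : P₀.PosDef)
    (hdet : S.Detectable) (hstab : S.Stabilizable Q R) :
    Tendsto
      (fun p : ℕ × ℕ =>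
        inducedTwoNorm ((S.smoothCov Q R P₀ (p.1 + 1))⁻¹ * S.couplingMatrix Q R P₀ p.1 p.2))
      (atTop ×ˢ atTop) (𝓝 0) := by
  obtain ⟨K, r, hK, hr, hr', h⟩ :=
    DescriptorSystem.exists_norm_sq_mul_couplingMatrix_le hdet hQ hR hP₀
  have h0 : inducedTwoNorm (0 : Matrix (Fin n) (Fin n) ℝ) = 0 := by simp [inducedTwoNorm]
  rw [← h0]
  -- By continuity of the norm, entrywise convergence suffices; column `j` is the image of a basis
  -- vector.
  refine (continuous_inducedTwoNorm.tendsto 0).comp ?_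
  refine tendsto_pi_nhds.2 fun i => tendsto_pi_nhds.2 fun j => ?_
  have hlim : Tendsto (fun p : ℕ × ℕ => √(K * r ^ (p.2 - 1))) (atTop ×ˢ atTop) (𝓝 0) := by
    have h1 : Tendsto (fun c : ℕ => √(K * r ^ (c - 1))) atTop (𝓝 √(K * 0)) :=
      (((tendsto_pow_atTop_nhds_zero_of_lt_one hr hr').comp (tendsto_sub_atTop_nat 1)).const_mul
        K).sqrt
    rw [mul_zero, Real.sqrt_zero] at h1
    exact h1.comp tendsto_snd
  refine squeeze_zero_norm' ?_ hlim
  filter_upwards [tendsto_snd.eventually (eventually_ge_atTop 1)] with p hp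
  obtain ⟨c, hc⟩ : ∃ c, p.2 = c + 1 := ⟨p.2 - 1, by omega⟩
  rw [hc, Nat.add_sub_cancel]
  refine Real.le_sqrt_of_sq_le ?_
  have h1 := h p.1 c (Pi.single j 1)
  rw [Pi.norm_single, norm_one, one_pow, mul_one, Matrix.mulVec_single_one] at h1
  exact le_trans (pow_le_pow_left₀ (norm_nonneg _) (norm_le_pi_norm (Matrix.col
    ((S.smoothCov Q R P₀ (p.1 + 1))⁻¹ * S.couplingMatrix Q R P₀ p.1 (c + 1)) j) i) 2) h1
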